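/- Let $U\subset\mathbb R^n$ be a bounded domain (open, connected, nonempty) with $C^\infty$ boundary, and let $H:\mathbb R^n\to\mathbb R$ satisfy (H1) $H$ is $C^\infty$ and $H(0)<0$; (H2) $H$ is coercive: $\displaystyle\lim_{|p|\to\infty}\frac{H(p)}{|p|}=+\infty$; (H3) there exist $\gamma,\delta>0$ such that $DH(p)\cdot p-\gamma H(p)\ge\delta$ for all $p\in\mathbb R^n$. (No convexity of $H$ is assumed.) Then there is a constant $C$, depending only on $U$ and $H$, such that for every $\varepsilon\in(0,1)$ and every classical solution $u^\varepsilon\in C^2(U)\cap C(\overline U)$ of $$H(Du^\varepsilon)=\varepsilon\,\Delta u^\varepsilon\ \text{ in } U,\qquad u^\varepsilon=0\ \text{ on }\partial U,$$ one has $$\|u^\varepsilon\|_{L^\infty(U)}+\|Du^\varepsilon\|_{L^\infty(U)}\le C.$$ -/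

import Mathlib

open Set Filter Topology MeasureTheory
open scoped ContDiff Laplacian Gradient

/-- `U` is a bounded domain of `ℝⁿ` (bounded, open, connected, nonempty) with `C^∞` boundary:
near each boundary point `x₀`, `U` is the set `{ρ < 0}` for a smooth local defining function `ρ`
with nonvanishing gradient at `x₀` (so `U` lies locally on one side of its boundary, the smooth
hypersurface `{ρ = 0}`). -/
structure IsSmoothBoundedDomain {n : ℕ} (U : Set (EuclideanSpace ℝ (Fin n))) : Prop where
  isOpen : IsOpen U
  isConnected : IsConnected U
  isBounded : Bornology.IsBounded U
  smooth_boundary : ∀ x₀ ∈ frontier U,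
    ∃ (V : Set (EuclideanSpace ℝ (Fin n))) (ρ : EuclideanSpace ℝ (Fin n) → ℝ),
      IsOpen V ∧ x₀ ∈ V ∧ ContDiffOn ℝ ∞ ρ V ∧ ∇ ρ x₀ ≠ 0 ∧ U ∩ V = {x ∈ V | ρ x < 0}

/-- `u ∈ C²(U) ∩ C(closure U)` is a classical solution of the Dirichlet problem
`H(Du) = ε Δu` in `U`, `u = 0` on `∂U`. -/
structure IsRegularizedSolution {n : ℕ} (U : Set (EuclideanSpace ℝ (Fin n)))
    (H : EuclideanSpace ℝ (Fin n) → ℝ) (ε : ℝ) (u : EuclideanSpace ℝ (Fin n) → ℝ) : Prop where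
  contDiffOn : ContDiffOn ℝ 2 u U
  continuousOn : ContinuousOn u (closure U)
  equation : ∀ x ∈ U, H (∇ u x) = ε * Δ u x
  boundary : ∀ x ∈ frontier U, u x = 0

/-! ### Second-order conditions at a local maximum and derivatives of model functions -/

section SecondOrder

variable {E : Type*} [NormedAddCommGroup E] [InnerProductSpace ℝ E]

/-! At an interior minimum `Du = 0` and `Δu ≥ 0`, contradicting `H 0 < 0`; hence `u ≥ 0`. Each
boundary point `x₀` is touched from outside by a ball of uniform radius (`exists_exterior_ball`),
and superlinear growth makes a quadratic in the distance to its centre a supersolution for all `ε <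
1` at once (`exists_quadratic_upper_barrier`), so `u x ≤ C * ‖x - x₀‖`. The equation is translation
invariant, so `u(· + h)` and `u` solve it together on `U ∩ (U - h)`. Their difference is largest on
the frontier (`sub_le_of_sub_le_on_frontier`), where it is at most `C * ‖h‖`. Thus `u` is
`C`-Lipschitz, without differentiating the equation. -/

theorem ContDiffAt.deriv_deriv_comp_line {f : E → ℝ} {x : E} (hf : ContDiffAt ℝ 2 f x) (v : E) :
    deriv (deriv fun t : ℝ => f (x + t • v)) 0 = fderiv ℝ (fderiv ℝ f) x v v := by
  have hline : ∀ t : ℝ, HasDerivAt (fun t : ℝ => x + t • v) v t := fun t => by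
    simpa using ((hasDerivAt_id t).smul_const v).const_add x
  have hcont : Tendsto (fun t : ℝ => x + t • v) (𝓝 0) (𝓝 x) := by
    simpa using (hline 0).continuousAt.tendsto
  have h1 : (deriv fun t : ℝ => f (x + t • v)) =ᶠ[𝓝 0] fun t => fderiv ℝ f (x + t • v) v := by
    filter_upwards [hcont.eventually (hf.eventually (by simp))] with t ht
    exact ((ht.differentiableAt (by simp)).hasFDerivAt.comp_hasDerivAt t (hline t)).deriv
  rw [h1.deriv_eq]
  have h2 : HasFDerivAt (fderiv ℝ f) (fderiv ℝ (fderiv ℝ f) x) x :=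
    ((hf.fderiv_right (m := 1) (by norm_num)).differentiableAt (by simp)).hasFDerivAt
  have h3 : HasFDerivAt (fun y => fderiv ℝ f y v) ((fderiv ℝ (fderiv ℝ f) x).flip v) x := by
    simpa using h2.clm_apply (hasFDerivAt_const v x)
  exact (h3.comp_hasDerivAt_of_eq (0 : ℝ) (hline 0) (by simp)).deriv

/-- A positive second derivative would make the point a local minimum too, hence `g` locally
constant. -/
theorem IsLocalMax.deriv_deriv_nonpos {g : ℝ → ℝ} {a : ℝ} (h : IsLocalMax g a)
    (hc : ContinuousAt g a) : deriv (deriv g) a ≤ 0 := by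
  by_contra! hpos
  have hmin := isLocalMin_of_deriv_deriv_pos hpos h.deriv_eq_zero hc
  have heq : g =ᶠ[𝓝 a] fun _ => g a := by
    filter_upwards [h, hmin] with t h1 h2 using le_antisymm h1 h2
  have : deriv (deriv g) a = 0 := by
    rw [heq.deriv.deriv_eq]; simp
  exact hpos.ne' this

theorem IsLocalMax.fderiv_fderiv_nonpos {f : E → ℝ} {x : E} (h : IsLocalMax f x)
    (hf : ContDiffAt ℝ 2 f x) (v : E) : fderiv ℝ (fderiv ℝ f) x v v ≤ 0 := by
  rw [← hf.deriv_deriv_comp_line]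
  have hl : ContinuousAt (fun t : ℝ => x + t • v) 0 := by fun_prop
  have hx : x + (0 : ℝ) • v = x := by simp
  refine IsLocalMax.deriv_deriv_nonpos ?_ ?_
  · have : Tendsto (fun t : ℝ => x + t • v) (𝓝 0) (𝓝 x) := by simpa using hl.tendsto
    simpa [IsLocalMax, IsMaxFilter] using this.eventually h
  · exact ContinuousAt.comp (g := f) (by rw [hx]; exact hf.continuousAt) hl

variable [FiniteDimensional ℝ E]

theorem laplacian_eq_sum_fderiv_fderiv (f : E → ℝ) (x : E) :
    Δ f x = ∑ i, fderiv ℝ (fderiv ℝ f) x (stdOrthonormalBasis ℝ E i)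
      (stdOrthonormalBasis ℝ E i) := by
  rw [InnerProductSpace.laplacian_eq_iteratedFDeriv_stdOrthonormalBasis]
  simp [iteratedFDeriv_two_apply]

theorem laplacian_comp_add_right (f : E → ℝ) (h x : E) :
    Δ (fun y => f (y + h)) x = Δ f (x + h) := by
  simp [InnerProductSpace.laplacian_eq_iteratedFDeriv_stdOrthonormalBasis,
    iteratedFDeriv_comp_add_right]

theorem gradient_comp_add_right (f : E → ℝ) (h x : E) :
    ∇ (fun y => f (y + h)) x = ∇ f (x + h) := by
  simp [gradient, fderiv_comp_add_right]

theorem IsLocalMax.laplacian_nonpos {f : E → ℝ} {x : E} (h : IsLocalMax f x)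
    (hf : ContDiffAt ℝ 2 f x) : Δ f x ≤ 0 := by
  rw [laplacian_eq_sum_fderiv_fderiv]
  exact Finset.sum_nonpos fun i _ => h.fderiv_fderiv_nonpos hf _

theorem IsLocalMax.gradient_eq_and_laplacian_le {f g : E → ℝ} {x : E}
    (h : IsLocalMax (f - g) x) (hf : ContDiffAt ℝ 2 f x) (hg : ContDiffAt ℝ 2 g x) :
    ∇ f x = ∇ g x ∧ Δ f x ≤ Δ g x := by
  constructor
  · have h0 := h.fderiv_eq_zero
    rw [fderiv_sub (hf.differentiableAt (by simp)) (hg.differentiableAt (by simp)),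
      sub_eq_zero] at h0
    simp [gradient, h0]
  · have h0 := h.laplacian_nonpos (hf.sub hg)
    rw [hf.laplacian_sub hg] at h0
    linarith

theorem hasGradientAt_mul_norm_sub_sq (K : ℝ) (c x : E) :
    HasGradientAt (fun y => K * ‖y - c‖ ^ 2) ((2 * K) • (x - c)) x := by
  rw [hasGradientAt_iff_hasFDerivAt]
  have h := (((hasFDerivAt_id x).sub_const c).norm_sq).const_mul K
  refine h.congr_fderiv ?_
  ext v
  simp
  ring

theorem laplacian_mul_norm_sub_sq (K : ℝ) (c x : E) :
    Δ (fun y => K * ‖y - c‖ ^ 2) x = 2 * K * Module.finrank ℝ E := by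
  have h1 : fderiv ℝ (fun y => K * ‖y - c‖ ^ 2) = fun y => (2 * K) • innerSL ℝ (y - c) := by
    funext y
    rw [(hasGradientAt_iff_hasFDerivAt.1 (hasGradientAt_mul_norm_sub_sq K c y)).fderiv]
    ext v
    simp
  have h2 : ∀ v, fderiv ℝ (fderiv ℝ fun y => K * ‖y - c‖ ^ 2) x v v = 2 * K * ‖v‖ ^ 2 := by
    intro v
    have h3 : HasFDerivAt (fun y : E => (2 * K) • innerSL ℝ (y - c)) ((2 * K) • innerSL ℝ) x :=
      ((innerSL ℝ).hasFDerivAt.comp x ((hasFDerivAt_id x).sub_const c)).const_smul (2 * K)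
    rw [h1, h3.fderiv, ← real_inner_self_eq_norm_sq]
    rfl
  rw [laplacian_eq_sum_fderiv_fderiv]
  simp_rw [h2]
  simp [mul_comm]

theorem hasGradientAt_exp_inner (η l : ℝ) (e x : E) :
    HasGradientAt (fun y => η * Real.exp (l * inner ℝ e y))
      ((η * l * Real.exp (l * inner ℝ e x)) • e) x := by
  rw [hasGradientAt_iff_hasFDerivAt]
  have h := ((((innerSL ℝ e).hasFDerivAt (x := x)).const_mul l).exp).const_mul η
  refine h.congr_fderiv ?_
  ext v
  simp
  ring

theorem laplacian_exp_inner (η l : ℝ) {e : E} (he : ‖e‖ = 1) (x : E) :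
    Δ (fun y => η * Real.exp (l * inner ℝ e y)) x
      = η * l ^ 2 * Real.exp (l * inner ℝ e x) := by
  have h1 : fderiv ℝ (fun y => η * Real.exp (l * inner ℝ e y))
      = fun y => (η * l * Real.exp (l * inner ℝ e y)) • innerSL ℝ e := by
    funext y
    rw [(hasGradientAt_iff_hasFDerivAt.1 (hasGradientAt_exp_inner η l e y)).fderiv]
    ext v
    simp
  have h2 : ∀ v, fderiv ℝ (fderiv ℝ fun y => η * Real.exp (l * inner ℝ e y)) x v v
      = (η * l ^ 2 * Real.exp (l * inner ℝ e x)) * inner ℝ e v ^ 2 := by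
    intro v
    rw [h1, ((hasGradientAt_iff_hasFDerivAt.1
      (hasGradientAt_exp_inner (η * l) l e x)).smul_const (innerSL ℝ e)).fderiv]
    simp
    ring
  rw [laplacian_eq_sum_fderiv_fderiv]
  simp_rw [h2]
  rw [← Finset.mul_sum]
  have := (stdOrthonormalBasis ℝ E).sum_sq_inner_left e
  simp [this, he]

end SecondOrder

/-! ### Maximum principles -/

section Comparison

variable {E : Type*} [NormedAddCommGroup E] [InnerProductSpace ℝ E] [FiniteDimensional ℝ E]

theorem ContDiff.exists_lipschitz_on_closedBall {H : E → ℝ} (hH : ContDiff ℝ 1 H) (D : ℝ) :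
    ∃ L : ℝ, 0 ≤ L ∧ ∀ p ∈ Metric.closedBall (0 : E) D, ∀ q ∈ Metric.closedBall (0 : E) D,
      |H p - H q| ≤ L * ‖p - q‖ := by
  obtain ⟨L, hL⟩ := (isCompact_closedBall (0 : E) D).exists_bound_of_continuousOn
    (hH.continuous_fderiv (by simp)).continuousOn
  refine ⟨max L 0, le_max_right _ _, fun p hp q hq => ?_⟩
  exact (convex_closedBall (0 : E) D).norm_image_sub_le_of_norm_fderiv_le
    (fun x _ => hH.differentiable (by simp) x) (fun x hx => (hL x hx).trans (le_max_left _ _)) hq hp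

theorem ContDiffOn.continuousOn_gradient {u : E → ℝ} {W : Set E} (hu : ContDiffOn ℝ 2 u W)
    (hW : IsOpen W) : ContinuousOn (∇ u) W :=
  (InnerProductSpace.toDual ℝ E).symm.continuous.comp_continuousOn
    (hu.continuousOn_fderiv_of_isOpen hW (by simp))

/-- Weak maximum principle for the difference of two solutions of `H(Du) = ε Δu`. -/
theorem sub_le_of_sub_le_on_frontier [Nontrivial E] {W : Set E} (hW : IsOpen W)
    (hWb : Bornology.IsBounded W) {H : E → ℝ} (hH : ContDiff ℝ 1 H) {ε : ℝ} (hε : 0 < ε)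
    {v w : E → ℝ} (hv : ContDiffOn ℝ 2 v W) (hw : ContDiffOn ℝ 2 w W)
    (hvc : ContinuousOn v (closure W)) (hwc : ContinuousOn w (closure W))
    (hveq : ∀ x ∈ W, H (∇ v x) = ε * Δ v x) (hweq : ∀ x ∈ W, H (∇ w x) = ε * Δ w x)
    {m : ℝ} (hm : ∀ x ∈ frontier W, v x - w x ≤ m) {x : E} (hx : x ∈ closure W) :
    v x - w x ≤ m := by
  by_contra! hlt
  obtain ⟨m', hmm', hm'⟩ := exists_between hlt
  have hK : IsCompact (closure W) := hWb.isCompact_closure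
  obtain ⟨e, he⟩ := exists_norm_eq E (zero_le_one' ℝ)
  -- Gradients may blow up at the frontier; on this compact subset of `W` they are bounded, so `H`
  -- is Lipschitz on the relevant range.
  set S : Set E := {y ∈ closure W | m' ≤ v y - w y}
  have hSW : S ⊆ W := fun y hy => by
    by_contra hyW
    have := hm y ⟨hy.1, by rwa [hW.interior_eq]⟩
    linarith [hy.2]
  have hS : IsCompact S :=
    hK.of_isClosed_subset ((hvc.sub hwc).preimage_isClosed_of_isClosed isClosed_closure isClosed_Ici)
      fun y hy => hy.1
  obtain ⟨D₁, hD₁⟩ := hS.exists_bound_of_continuousOn ((hv.continuousOn_gradient hW).mono hSW)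
  obtain ⟨D₂, hD₂⟩ := hS.exists_bound_of_continuousOn ((hw.continuousOn_gradient hW).mono hSW)
  obtain ⟨L, hL0, hL⟩ := hH.exists_lipschitz_on_closedBall (max D₁ D₂)
  -- Adding `g = η exp(l⟨e, ·⟩)` gains `ε l² g` in the Laplacian term and costs at most `L l g`
  -- through `H`; `ε l > L` makes the gain win.
  set l : ℝ := (L + 1) / ε
  have hl : 0 < l := by positivity
  have hlε : ε * l = L + 1 := by simp only [l]; field_simp
  obtain ⟨G, hG⟩ := hK.exists_bound_of_continuousOn (f := fun y : E => Real.exp (l * inner ℝ e y))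
    (by fun_prop)
  have hGx := hG x hx
  rw [Real.norm_of_nonneg (Real.exp_pos _).le] at hGx
  have hG0 : 0 < G := (Real.exp_pos _).trans_le hGx
  -- Small enough that the maximiser of `v - w + g` stays in `S`.
  set η : ℝ := (v x - w x - m') / G
  have hη : 0 < η := div_pos (by linarith) hG0
  have hηG : η * G = v x - w x - m' := by simp only [η]; field_simp
  set g : E → ℝ := fun y => η * Real.exp (l * inner ℝ e y)
  have hgc : ContDiff ℝ 2 g :=
    contDiff_const.mul (contDiff_const.mul (innerSL ℝ e).contDiff).exp
  obtain ⟨y, hy, hmax⟩ := hK.exists_isMaxOn ⟨x, hx⟩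
    (hvc.sub (hwc.sub hgc.continuous.continuousOn))
  have hyS : y ∈ S := by
    refine ⟨hy, ?_⟩
    have h1 : v x - (w x - g x) ≤ v y - (w y - g y) := hmax hx
    have h2 : 0 < g x := by positivity
    have h3 : g y ≤ η * G := by
      have := hG y hy
      rw [Real.norm_of_nonneg (Real.exp_pos _).le] at this
      exact mul_le_mul_of_nonneg_left this hη.le
    linarith
  have hyW := hSW hyS
  have hWn : W ∈ 𝓝 y := hW.mem_nhds hyW
  have hloc : IsLocalMax (v - (w - g)) y := hmax.isLocalMax (mem_of_superset hWn subset_closure)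
  have hwy := hw.contDiffAt hWn
  have hgy := hgc.contDiffAt (x := y)
  obtain ⟨hgrad, hlap⟩ := hloc.gradient_eq_and_laplacian_le (hv.contDiffAt hWn) (hwy.sub hgy)
  have hgg : ∇ (w - g) y = ∇ w y - (l * g y) • e := by
    have h := (hwy.differentiableAt (by simp)).hasGradientAt.hasFDerivAt.sub
      (hasGradientAt_exp_inner η l e y).hasFDerivAt
    rw [← map_sub] at h
    rw [(hasGradientAt_iff_hasFDerivAt.2 h).gradient]
    congr 2
    simp only [g]; ring
  have hgl : Δ (w - g) y = Δ w y - l ^ 2 * g y := by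
    rw [hwy.laplacian_sub hgy, laplacian_exp_inner η l he]
    simp only [g]; ring
  have hgpos : 0 < g y := by positivity
  have hLip := hL (∇ v y) (mem_closedBall_zero_iff.2 ((hD₁ y hyS).trans (le_max_left _ _)))
    (∇ w y) (mem_closedBall_zero_iff.2 ((hD₂ y hyS).trans (le_max_right _ _)))
  rw [hveq y hyW, hweq y hyW, hgrad, hgg, sub_sub_cancel_left, norm_neg, norm_smul, he,
    Real.norm_of_nonneg (by positivity)] at hLip
  have h1 := (abs_le.1 hLip).1
  have h2 : ε * Δ v y ≤ ε * Δ w y - ε * l * (l * g y) := by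
    rw [hgl] at hlap
    nlinarith
  rw [hlε] at h2
  nlinarith [mul_pos hl hgpos]

/-- Comparison of a subsolution with a strict supersolution. -/
theorem le_of_strict_supersolution {U : Set E} (hU : IsOpen U)
    (hUb : Bornology.IsBounded U) {H : E → ℝ} {ε : ℝ} (hε : 0 < ε)
    {u w : E → ℝ} (hu : ContDiffOn ℝ 2 u U) (hw : ContDiff ℝ 2 w)
    (huc : ContinuousOn u (closure U)) (hueq : ∀ x ∈ U, H (∇ u x) = ε * Δ u x)
    (hweq : ∀ x ∈ U, ε * Δ w x < H (∇ w x)) (hle : ∀ x ∈ frontier U, u x ≤ w x)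
    {x : E} (hx : x ∈ closure U) : u x ≤ w x := by
  obtain ⟨y, hy, hmax⟩ := hUb.isCompact_closure.exists_isMaxOn ⟨x, hx⟩
    (huc.sub hw.continuous.continuousOn)
  have hxy : u x - w x ≤ u y - w y := hmax hx
  by_cases hyU : y ∈ U
  · have hUn := hU.mem_nhds hyU
    have hloc : IsLocalMax (u - w) y := hmax.isLocalMax (mem_of_superset hUn subset_closure)
    obtain ⟨h1, h2⟩ := hloc.gradient_eq_and_laplacian_le (hu.contDiffAt hUn) hw.contDiffAt
    have h3 := hueq y hyU
    have h4 := hweq y hyU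
    rw [h1] at h3
    linarith [mul_le_mul_of_nonneg_left h2 hε.le]
  · have := hle y ⟨hy, by rwa [hU.interior_eq]⟩
    linarith

end Comparison

/-! ### Bounds on solutions: sign, barrier, translation -/

section Solution

variable {n : ℕ} {U : Set (EuclideanSpace ℝ (Fin n))} {H u : EuclideanSpace ℝ (Fin n) → ℝ} {ε : ℝ}

/-- A solution attains its minimum over `closure U` only on the boundary. -/
theorem IsRegularizedSolution.exists_frontier_isMinOn (hu : IsRegularizedSolution U H ε u)
    (hU : IsSmoothBoundedDomain U) (hH : H 0 < 0) (hε : 0 < ε) :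
    ∃ y ∈ frontier U, IsMinOn u (closure U) y := by
  obtain ⟨y, hy, hmin⟩ := hU.isBounded.isCompact_closure.exists_isMinOn
    hU.isConnected.nonempty.closure hu.continuousOn
  refine ⟨y, ⟨hy, fun hyU => ?_⟩, hmin⟩
  rw [hU.isOpen.interior_eq] at hyU
  have hUn := hU.isOpen.mem_nhds hyU
  have hloc : IsLocalMax (0 - u) y := by
    rw [zero_sub]
    exact (hmin.isLocalMin (mem_of_superset hUn subset_closure)).neg
  obtain ⟨h1, h2⟩ := hloc.gradient_eq_and_laplacian_le contDiffAt_const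
    (hu.contDiffOn.contDiffAt hUn)
  have h0 : ∇ (0 : EuclideanSpace ℝ (Fin n) → ℝ) y = 0 := by simp [gradient]
  have h3 : Δ (0 : EuclideanSpace ℝ (Fin n) → ℝ) y = 0 := by
    simp [laplacian_eq_sum_fderiv_fderiv]
  rw [h3] at h2
  have h4 := hu.equation y hyU
  rw [← h1, h0] at h4
  nlinarith

theorem IsRegularizedSolution.nonneg (hu : IsRegularizedSolution U H ε u)
    (hU : IsSmoothBoundedDomain U) (hH : H 0 < 0) (hε : 0 < ε)
    {x : EuclideanSpace ℝ (Fin n)} (hx : x ∈ closure U) : 0 ≤ u x := by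
  obtain ⟨y, hy, hmin⟩ := hu.exists_frontier_isMinOn hU hH hε
  rw [← hu.boundary y hy]
  exact hmin hx

/-- Superlinear growth makes `K (‖x - c‖² - r²)` a strict supersolution outside `ball c r`, for
every `ε < 1`. -/
theorem exists_quadratic_upper_barrier (hU : IsSmoothBoundedDomain U)
    (hH : Tendsto (fun p => H p / ‖p‖) (Bornology.cobounded (EuclideanSpace ℝ (Fin n))) atTop)
    {r : ℝ} (hr : 0 < r) :
    ∃ K : ℝ, 0 < K ∧ ∀ ε, 0 < ε → ε < 1 → ∀ u, IsRegularizedSolution U H ε u →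
      ∀ c, (∀ x ∈ U, r ≤ ‖x - c‖) → ∀ x ∈ closure U, u x ≤ K * (‖x - c‖ ^ 2 - r ^ 2) := by
  obtain ⟨P, hP⟩ : ∃ P : ℝ, ∀ p : EuclideanSpace ℝ (Fin n), P ≤ ‖p‖ → (n + 1) / r ≤ H p / ‖p‖ := by
    have h := hH.eventually_ge_atTop ((n + 1) / r)
    rw [← comap_norm_atTop, eventually_comap] at h
    obtain ⟨P, hP⟩ := eventually_atTop.1 h
    exact ⟨P, fun p hp => hP _ hp p rfl⟩
  -- Outside the ball the barrier's gradient has norm at least `2 * K * r ≥ P`, so `H` there is at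
  -- least `2 * K * (n + 1)`, above the Laplacian `2 * K * n`.
  set K : ℝ := max P 1 / (2 * r)
  have hK : 0 < K := by positivity
  have hKr : 2 * K * r = max P 1 := by simp only [K]; field_simp
  refine ⟨K, hK, fun ε hε hε1 u hu c hc x hx => ?_⟩
  have hcl : ∀ y ∈ closure U, r ≤ ‖y - c‖ := fun y hy =>
    closure_minimal hc (isClosed_le (f := fun _ => r) (g := fun z => ‖z - c‖)
      (by fun_prop) (by fun_prop)) hy
  have hcm := le_of_strict_supersolution (w := fun y => K * ‖y - c‖ ^ 2 - K * r ^ 2)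
    hU.isOpen hU.isBounded hε hu.contDiffOn
    ((contDiff_const.mul ((contDiff_id.sub contDiff_const).norm_sq ℝ)).sub contDiff_const)
    hu.continuousOn hu.equation ?_ ?_ hx
  · linarith
  · intro y hy
    have h1 : ∇ (fun y => K * ‖y - c‖ ^ 2 - K * r ^ 2) y = (2 * K) • (y - c) := by
      refine HasGradientAt.gradient (hasGradientAt_iff_hasFDerivAt.2 ?_)
      exact (hasGradientAt_mul_norm_sub_sq K c y).hasFDerivAt.sub_const _
    have h2 : Δ (fun y => K * ‖y - c‖ ^ 2 - K * r ^ 2) y = 2 * K * n := by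
      have h3 : ContDiffAt ℝ 2 (fun y => K * ‖y - c‖ ^ 2) y :=
        (contDiff_const.mul ((contDiff_id.sub contDiff_const).norm_sq ℝ)).contDiffAt
      have h4 := h3.laplacian_sub (f₂ := fun _ => K * r ^ 2) contDiffAt_const
      rw [InnerProductSpace.laplacian_const, laplacian_mul_norm_sub_sq, finrank_euclideanSpace,
        Fintype.card_fin] at h4
      exact h4.trans (sub_zero _)
    have hn : ‖(2 * K) • (y - c)‖ = 2 * K * ‖y - c‖ := by
      rw [norm_smul, Real.norm_of_nonneg (by positivity)]
    have hge : 2 * K * r ≤ 2 * K * ‖y - c‖ := by gcongr; exact hc y hy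
    have hpos : 0 < 2 * K * r := by positivity
    have hHy := hP ((2 * K) • (y - c)) (by rw [hn]; linarith [le_max_left P 1])
    rw [hn, le_div_iff₀ (by linarith)] at hHy
    rw [h1, h2]
    have h5 : (n + 1) / r * (2 * K * r) ≤ (n + 1) / r * (2 * K * ‖y - c‖) := by gcongr
    have h6 : (n + 1) / r * (2 * K * r) = 2 * K * n + 2 * K := by field_simp
    have h7 : ε * (2 * K * n) ≤ 1 * (2 * K * n) := by gcongr
    linarith
  · intro y hy
    rw [hu.boundary y hy]
    have := hcl y hy.1
    have : r ^ 2 ≤ ‖y - c‖ ^ 2 := by gcongr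
    nlinarith

/-- A uniform linear bound at the boundary propagates to a global Lipschitz bound, because the
equation is translation invariant. -/
theorem IsRegularizedSolution.sub_le [Nontrivial (EuclideanSpace ℝ (Fin n))]
    (hu : IsRegularizedSolution U H ε u) (hU : IsSmoothBoundedDomain U) (hH : ContDiff ℝ 1 H)
    (hH0 : H 0 < 0) (hε : 0 < ε) {C : ℝ} (hC : 0 ≤ C)
    (hbd : ∀ x₀ ∈ frontier U, ∀ x ∈ closure U, u x ≤ C * ‖x - x₀‖)
    {x y : EuclideanSpace ℝ (Fin n)} (hx : x ∈ U) (hy : y ∈ U) : u y - u x ≤ C * ‖y - x‖ := by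
  set h := y - x
  set W : Set (EuclideanSpace ℝ (Fin n)) := U ∩ (· + h) ⁻¹' U
  have hcont : Continuous fun z : EuclideanSpace ℝ (Fin n) => z + h := by fun_prop
  have hWo : IsOpen W := hU.isOpen.inter (hU.isOpen.preimage hcont)
  have hW1 : closure W ⊆ closure U := closure_mono inter_subset_left
  have hW2 : ∀ z ∈ closure W, z + h ∈ closure U := fun z hz =>
    (hcont.closure_preimage_subset U) (closure_mono inter_subset_right hz)
  have hxW : x ∈ W := ⟨hx, by simpa [h] using hy⟩
  have key := sub_le_of_sub_le_on_frontier (v := fun z => u (z + h)) (w := u) (m := C * ‖h‖) hWo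
    (hU.isBounded.subset inter_subset_left) hH hε
    (hu.contDiffOn.comp (by fun_prop) inter_subset_right) (hu.contDiffOn.mono inter_subset_left)
    (hu.continuousOn.comp hcont.continuousOn hW2) (hu.continuousOn.mono hW1)
    (fun z hz => by
      rw [gradient_comp_add_right, laplacian_comp_add_right]
      exact hu.equation _ hz.2)
    (fun z hz => hu.equation z hz.1) ?_ (subset_closure hxW)
  · simpa [h] using key
  · intro z hz
    have hz1 := hW1 hz.1
    have hz2 := hW2 z hz.1
    -- On the frontier of `W`, either `z + h` or `z` lies on the frontier of `U`: the first case
    -- uses `u ≥ 0`, the second the linear bound.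
    by_cases hzU : z ∈ U
    · have hzh : z + h ∈ frontier U := by
        refine ⟨hz2, fun hi => hz.2 ?_⟩
        rw [hU.isOpen.interior_eq] at hi
        rw [hWo.interior_eq]
        exact ⟨hzU, hi⟩
      have h1 := hu.boundary _ hzh
      have h2 := hu.nonneg hU hH0 hε hz1
      have h3 : 0 ≤ C * ‖h‖ := by positivity
      linarith
    · have hzf : z ∈ frontier U := ⟨hz1, by rwa [hU.isOpen.interior_eq]⟩
      have h1 := hbd z hzf _ hz2
      rw [add_sub_cancel_left] at h1
      linarith [hu.boundary z hzf]

end Solution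

/-! ### Exterior balls from the smooth boundary -/

section ExteriorBall

variable {n : ℕ} {U : Set (EuclideanSpace ℝ (Fin n))}

/-- The centre lies along `∇ρ(x)`. A point `y ∈ U` inside the ball would satisfy `N d² < 2r⟨∇ρ(x), y
- x⟩`, while `ρ y < 0 ≤ ρ x` and Taylor's formula bound the inner product by `M d²`: impossible for
small `r`. Allowing every `r ≤ r₀` lets compactness choose one common radius. -/
theorem IsSmoothBoundedDomain.exterior_ball_near (hU : IsSmoothBoundedDomain U)
    {x₀ : EuclideanSpace ℝ (Fin n)} (hx₀ : x₀ ∈ frontier U) :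
    ∃ r₀ > 0, ∃ s > 0, ∀ x ∈ frontier U ∩ Metric.ball x₀ s, ∀ r, 0 < r → r ≤ r₀ →
      ∃ c, ‖x - c‖ = r ∧ ∀ y ∈ U, r ≤ ‖y - c‖ := by
  obtain ⟨V, ρ, hV, hxV, hρ, hgrad, hUV⟩ := hU.smooth_boundary x₀ hx₀
  have hρ₀ : ContDiffAt ℝ ∞ ρ x₀ := hρ.contDiffAt (hV.mem_nhds hxV)
  have hDρ : ContDiffAt ℝ 1 (fderiv ℝ ρ) x₀ := hρ₀.fderiv_right (by norm_cast)
  obtain ⟨M, t, ht, hM⟩ := hDρ.exists_lipschitzOnWith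
  set m := ‖fderiv ℝ ρ x₀‖ / 2
  have hpos : 0 < ‖fderiv ℝ ρ x₀‖ := by
    rw [norm_pos_iff]
    intro h
    exact hgrad (by simp [gradient, h])
  have hm : 0 < m := half_pos hpos
  have hmn : ∀ᶠ x in 𝓝 x₀, m < ‖fderiv ℝ ρ x‖ :=
    hDρ.continuousAt.norm.eventually (lt_mem_nhds (half_lt_self hpos))
  obtain ⟨s, hs, hball⟩ := Metric.mem_nhds_iff.1
    (inter_mem (inter_mem (hV.mem_nhds hxV) ht) hmn)
  -- `s / 4` keeps the points within `2 * r` of `x` inside `ball x₀ s`; the other term gives `2 * r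
  -- * (M + 1) ≤ m < N`.
  refine ⟨min (s / 4) (m / (2 * (M + 1))), by positivity, s / 2, by positivity, ?_⟩
  rintro x ⟨hxf, hxs⟩ r hr hrle
  have hrs : r ≤ s / 4 := hrle.trans (min_le_left _ _)
  have hrm : r * (2 * (M + 1)) ≤ m := by
    rw [← le_div_iff₀ (by positivity)]
    exact hrle.trans (min_le_right _ _)
  rw [Metric.mem_ball] at hxs
  have hxB := hball (Metric.mem_ball.2 (show dist x x₀ < s by linarith))
  have hxU : x ∉ U := by
    have := hxf.2
    rwa [hU.isOpen.interior_eq] at this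
  have hρx : 0 ≤ ρ x := by
    by_contra! h
    have : x ∈ U ∩ V := by rw [hUV]; exact ⟨hxB.1.1, h⟩
    exact hxU this.1
  set N := ‖∇ ρ x‖
  have hN : m < N := by
    have : N = ‖fderiv ℝ ρ x‖ := by simp [N, gradient]
    rw [this]
    exact hxB.2
  have hN0 : 0 < N := hm.trans hN
  refine ⟨x + (r / N) • ∇ ρ x, ?_, fun y hy => ?_⟩
  · rw [sub_add_cancel_left, norm_neg, norm_smul, Real.norm_of_nonneg (by positivity)]
    exact div_mul_cancel₀ r hN0.ne'
  by_contra! hlt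
  set d := ‖y - x‖
  have hsplit : y - (x + (r / N) • ∇ ρ x) = (y - x) - (r / N) • ∇ ρ x := by abel
  have hnorm : ‖(r / N) • ∇ ρ x‖ = r := by
    rw [norm_smul, Real.norm_of_nonneg (by positivity)]
    exact div_mul_cancel₀ r hN0.ne'
  rw [hsplit] at hlt
  have hd : d < 2 * r := by
    have := norm_sub_norm_le (y - x) ((r / N) • ∇ ρ x)
    rw [hnorm] at this
    linarith
  have hsq : d ^ 2 < 2 * (r / N) * inner ℝ (∇ ρ x) (y - x) := by
    have h1 := norm_sub_sq_real (y - x) ((r / N) • ∇ ρ x)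
    rw [hnorm, inner_smul_right, real_inner_comm] at h1
    have h2 : ‖y - x - (r / N) • ∇ ρ x‖ ^ 2 < r ^ 2 := by gcongr
    linarith
  have hsub : Metric.closedBall x d ⊆ Metric.ball x₀ s := by
    intro z hz
    rw [Metric.mem_closedBall] at hz
    rw [Metric.mem_ball]
    linarith [dist_triangle z x x₀]
  have hyB : y ∈ Metric.closedBall x d := by simp [d, dist_eq_norm]
  have htaylor : ‖ρ y - ρ x - fderiv ℝ ρ x (y - x)‖ ≤ M * d * ‖y - x‖ := by
    refine (convex_closedBall x d).norm_image_sub_le_of_norm_fderiv_le' (fun z hz => ?_)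
      (fun z hz => ?_) (Metric.mem_closedBall_self (norm_nonneg _)) hyB
    · exact (hρ.contDiffAt (hV.mem_nhds (hball (hsub hz)).1.1)).differentiableAt (by simp)
    · have h1 := hM.norm_sub_le (hball (hsub hz)).1.2 hxB.1.2
      rw [Metric.mem_closedBall, dist_eq_norm] at hz
      exact h1.trans (by gcongr)
  have hρy : ρ y < 0 := by
    have : y ∈ U ∩ V := ⟨hy, (hball (hsub hyB)).1.1⟩
    rw [hUV] at this
    exact this.2
  rw [← inner_gradient_left, Real.norm_eq_abs] at htaylor
  have hin : inner ℝ (∇ ρ x) (y - x) < M * d ^ 2 := by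
    have := (abs_le.1 htaylor).1
    have h2 : M * d * ‖y - x‖ = M * d ^ 2 := by ring
    linarith
  have h3 : N * d ^ 2 < 2 * r * inner ℝ (∇ ρ x) (y - x) := by
    have := mul_lt_mul_of_pos_left hsq hN0
    have h4 : N * (2 * (r / N) * inner ℝ (∇ ρ x) (y - x)) = 2 * r * inner ℝ (∇ ρ x) (y - x) := by
      field_simp
    linarith
  have h5 : 2 * r * inner ℝ (∇ ρ x) (y - x) ≤ 2 * r * (M * d ^ 2) := by gcongr
  have h6 : m * d ^ 2 ≤ N * d ^ 2 := by gcongr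
  have h7 : r * (2 * (M + 1)) * d ^ 2 ≤ m * d ^ 2 := by gcongr
  have h8 : 0 ≤ 2 * r * d ^ 2 := by positivity
  nlinarith

/-- Uniform exterior ball condition. -/
theorem IsSmoothBoundedDomain.exists_exterior_ball (hU : IsSmoothBoundedDomain U) :
    ∃ r > 0, ∀ x ∈ frontier U, ∃ c, ‖x - c‖ = r ∧ ∀ y ∈ U, r ≤ ‖y - c‖ := by
  have hK : IsCompact (frontier U) :=
    hU.isBounded.isCompact_closure.of_isClosed_subset isClosed_frontier frontier_subset_closure
  obtain ⟨r, hr, h⟩ := hK.induction_on (p := fun s => ∃ r₀ > 0, ∀ x ∈ s, ∀ r, 0 < r → r ≤ r₀ →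
      ∃ c, ‖x - c‖ = r ∧ ∀ y ∈ U, r ≤ ‖y - c‖) ⟨1, one_pos, by simp⟩
    (fun s t hst ⟨r, hr, h⟩ => ⟨r, hr, fun x hx => h x (hst hx)⟩)
    (fun s t ⟨r₁, hr₁, h₁⟩ ⟨r₂, hr₂, h₂⟩ => ⟨min r₁ r₂, lt_min hr₁ hr₂, fun x hx r hr hle =>
      hx.elim (fun hx => h₁ x hx r hr (hle.trans (min_le_left _ _)))
        fun hx => h₂ x hx r hr (hle.trans (min_le_right _ _))⟩)
    (fun x hx => by
      obtain ⟨r₀, hr₀, s, hs, h⟩ := hU.exterior_ball_near hx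
      exact ⟨frontier U ∩ Metric.ball x s,
        inter_mem self_mem_nhdsWithin (mem_nhdsWithin_of_mem_nhds (Metric.ball_mem_nhds x hs)),
        r₀, hr₀, h⟩)
  exact ⟨r, hr, fun x hx => h x hx r hr le_rfl⟩

end ExteriorBall

/-! ### Uniform boundary growth and the final estimate -/

/-- Linear growth away from the boundary, uniformly in `ε` and in the solution. -/
theorem exists_linear_bound_at_frontier {n : ℕ} {U : Set (EuclideanSpace ℝ (Fin n))}
    {H : EuclideanSpace ℝ (Fin n) → ℝ} (hU : IsSmoothBoundedDomain U)
    (hH : Tendsto (fun p => H p / ‖p‖) (Bornology.cobounded (EuclideanSpace ℝ (Fin n))) atTop) :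
    ∃ C : ℝ, 0 ≤ C ∧ ∀ ε, 0 < ε → ε < 1 → ∀ u, IsRegularizedSolution U H ε u →
      ∀ x₀ ∈ frontier U, ∀ x ∈ closure U, u x ≤ C * ‖x - x₀‖ := by
  obtain ⟨r, hr, hball⟩ := hU.exists_exterior_ball
  obtain ⟨K, hK, hbar⟩ := exists_quadratic_upper_barrier hU hH hr
  -- With `d = ‖x - x₀‖`, `(d + r)² - r² = d (d + 2r)` and `d` is at most the diameter.
  refine ⟨K * (Metric.diam (closure U) + 2 * r), by positivity, ?_⟩
  intro ε hε hε1 u hu x₀ hx₀ x hx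
  obtain ⟨c, hc, hcU⟩ := hball x₀ hx₀
  have h1 := hbar ε hε hε1 u hu c hcU x hx
  have h2 : ‖x - c‖ ≤ ‖x - x₀‖ + r := by
    rw [← hc]
    exact norm_sub_le_norm_sub_add_norm_sub x x₀ c
  have h3 : ‖x - x₀‖ ≤ Metric.diam (closure U) := by
    rw [← dist_eq_norm]
    exact Metric.dist_le_diam_of_mem hU.isBounded.closure hx hx₀.1
  have h4 : ‖x - c‖ ^ 2 ≤ (‖x - x₀‖ + r) ^ 2 := by gcongr
  have h5 : ‖x - x₀‖ * ‖x - x₀‖ ≤ Metric.diam (closure U) * ‖x - x₀‖ := by gcongr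
  calc u x ≤ K * (‖x - c‖ ^ 2 - r ^ 2) := h1
    _ ≤ K * ((Metric.diam (closure U) + 2 * r) * ‖x - x₀‖) := by
        gcongr
        linarith
    _ = K * (Metric.diam (closure U) + 2 * r) * ‖x - x₀‖ := by ring

theorem mainTheorem5 {n : ℕ} (U : Set (EuclideanSpace ℝ (Fin n))) (hU : IsSmoothBoundedDomain U)
    (H : EuclideanSpace ℝ (Fin n) → ℝ)
    (hH_smooth : ContDiff ℝ ∞ H) (hH_zero : H 0 < 0)
    (hH_coercive : Tendsto (fun p => H p / ‖p‖)
      (Bornology.cobounded (EuclideanSpace ℝ (Fin n))) atTop)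
    (hH_hom : ∃ γ > 0, ∃ δ > 0, ∀ p, inner ℝ (∇ H p) p - γ * H p ≥ δ) :
    ∃ C : ℝ, ∀ ε : ℝ, 0 < ε → ε < 1 →
      ∀ u : EuclideanSpace ℝ (Fin n) → ℝ, IsRegularizedSolution U H ε u →
        eLpNorm u ⊤ (volume.restrict U) + eLpNorm (∇ u) ⊤ (volume.restrict U)
          ≤ ENNReal.ofReal C := by
  obtain ⟨C, hC, hbd⟩ := exists_linear_bound_at_frontier hU hH_coercive
  refine ⟨C * Metric.diam (closure U) + C, fun ε hε hε1 u hu => ?_⟩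
  obtain ⟨x₀, hx₀, -⟩ := hu.exists_frontier_isMinOn hU hH_zero hε
  -- For `n = 0` the frontier would be empty, but it contains `x₀`.
  have : Nontrivial (EuclideanSpace ℝ (Fin n)) := by
    by_contra hn
    rw [not_nontrivial_iff_subsingleton] at hn
    rw [(isClopen_discrete U).frontier_eq] at hx₀
    exact hx₀
  have hH1 : ContDiff ℝ 1 H := hH_smooth.of_le (by norm_cast)
  have hbdu := hbd ε hε hε1 u hu
  rw [ENNReal.ofReal_add (by positivity) hC, eLpNorm_exponent_top, eLpNorm_exponent_top]
  refine add_le_add (eLpNormEssSup_le_of_ae_bound ?_) (eLpNormEssSup_le_of_ae_bound ?_) <;>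
    refine ae_restrict_of_forall_mem hU.isOpen.measurableSet fun x hx => ?_
  · rw [Real.norm_of_nonneg (hu.nonneg hU hH_zero hε (subset_closure hx))]
    refine (hbdu x₀ hx₀ x (subset_closure hx)).trans ?_
    rw [← dist_eq_norm]
    gcongr
    exact Metric.dist_le_diam_of_mem hU.isBounded.closure (subset_closure hx) hx₀.1
  · have h1 : ‖fderiv ℝ u x‖ ≤ C := by
      refine norm_fderiv_le_of_lip' ℝ hC ?_
      filter_upwards [hU.isOpen.mem_nhds hx] with y hy
      rw [Real.norm_eq_abs, abs_le]
      have h1 := hu.sub_le hU hH1 hH_zero hε hC hbdu hx hy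
      have h2 := hu.sub_le hU hH1 hH_zero hε hC hbdu hy hx
      rw [norm_sub_rev] at h2
      constructor <;> linarith
    simpa [gradient] using h1
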